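/- A labelled connected marked graph (lcmg) $(X,v)$ is a connected directed graph $X$ (any two vertices are joined by a directed path) with countable vertex set $V(X)$, finite in- and out-degree at every vertex, at most one edge $(u,w)$ from $u$ to $w$ for each ordered pair of vertices (in particular at most one loop at each vertex), a label $L_X(u,w)\in\mathbb{C}$ (possibly $0$) on each edge $(u,w)$, and a marked vertex $v$. Let $d_X(u,w)$ be the minimum length of a directed path from $u$ to $w$, and let $B(X,v,r)$ be the full labelled subgraph, marked at $v$, on the vertices $u$ with $d_X(u,v)\le r$. Two marked labelled graphs are isomorphic if there is a bijection of their vertices that preserves the marked vertex, preserves edges in both directions and preserves labels. Put $$\mathcal{D}\big((X_1,v_1),(X_2,v_2)\big)=\inf\Big\{\tfrac{1}{n+1} : n\in\mathbb{N},\ B(X_1,v_1,n)\cong B(X_2,v_2,n)\Big\}\qquad(\inf\emptyset=\infty).$$ An lcmg is self-involutive if it is equal to the lcmg obtained by reversing all edges and conjugating all labels, i.e. if for every edge $(u,w)$ also $(w,u)$ is an edge and $L_X(w,u)=\overline{L_X(u,w)}$. The Markov-type operator of $X$ is $$(M_Xf)(u)=\sum_{(w,u)\in E(X)}L_X(w,u)\,f(w),\qquad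 f\in\ell^2(V(X)),\ u\in V(X).$$ If $X$ is self-involutive and $M_X$ maps $\ell^2(V(X))$ into itself, then $M_X$ is a bounded self-adjoint operator on $\ell^2(V(X))$; with $E^{M_X}$ its spectral projections, the Kesten spectral measure of $X$ at a vertex $x$ is the Borel probability measure $\mu^X_x(B)=\langle E^{M_X}_B\delta_x,\delta_x\rangle$ on $\mathbb{R}$. **Theorem.** Let $(X_n,v_n)_{n\in\mathbb{N}}$ and $(X,v)$ be self-involutive lcmg's whose Markov-type operators map $\ell^2$ into $\ell^2$. If $\mathcal{D}\big((X_n,v_n),(X,v)\big)\to 0$ as $n\to\infty$, then the Kesten spectral measures $\mu^{X_n}_{v_n}$ converge weakly to $\mu^X_v$. -/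

import Mathlib

universe u

open MeasureTheory Filter Topology
open scoped ENNReal ComplexConjugate

/-- A directed graph whose edges carry complex labels, with a marked vertex. Between an ordered
pair of vertices there is at most one edge, and at most one loop at each vertex. -/
structure MarkedLabelledGraph where
  /-- vertices -/
  V : Type u
  /-- `Adj u w` means that there is a directed edge `(u, w)` from `u` to `w` -/
  Adj : V → V → Prop
  /-- the complex label of each edge; the label `0` is allowed -/
  label : ∀ u w : V, Adj u w → ℂ
  /-- the marked vertex -/
  root : V

namespace MarkedLabelledGraph

/-- There is a directed walk with exactly `n` edges from `u` to `w`. -/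
def HasWalk (X : MarkedLabelledGraph.{u}) (u w : X.V) (n : ℕ) : Prop :=
  ∃ p : ℕ → X.V, p 0 = u ∧ p n = w ∧ ∀ i < n, X.Adj (p i) (p (i + 1))

/-- The minimum length of a directed path from `u` to `w`. -/
noncomputable def dist (X : MarkedLabelledGraph.{u}) (u w : X.V) : ℕ :=
  sInf {n : ℕ | X.HasWalk u w n}

/-- Isomorphism: a bijection of the vertices that preserves the marked vertex, the edges (in both
directions) and the labels. -/
def Isomorphic (X Y : MarkedLabelledGraph.{u}) : Prop :=
  ∃ f : X.V ≃ Y.V, f X.root = Y.root ∧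
    ∃ hf : ∀ u w, X.Adj u w ↔ Y.Adj (f u) (f w),
      ∀ u w (h : X.Adj u w), X.label u w h = Y.label (f u) (f w) ((hf u w).1 h)

/-- All edges are reversed and their labels are conjugated. -/
def involution (X : MarkedLabelledGraph.{u}) : MarkedLabelledGraph.{u} where
  V := X.V
  Adj u w := X.Adj w u
  label u w h := conj (X.label w u h)
  root := X.root

theorem involution_eq_self_iff (X : MarkedLabelledGraph.{u}) :
    X.involution = X ↔ ∃ h : ∀ u w, X.Adj u w ↔ X.Adj w u,
      ∀ u w (e : X.Adj u w), X.label u w e = conj (X.label w u ((h u w).1 e)) := by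
  obtain ⟨V, A, L, r⟩ := X
  simp only [involution, mk.injEq, heq_eq_eq, true_and, and_true]
  constructor
  · rintro ⟨h1, h2⟩
    have hs : ∀ u w, A u w ↔ A w u := fun u w => iff_of_eq (congrFun (congrFun h1 w) u)
    refine ⟨hs, fun u w e => ?_⟩
    have key : ∀ (B : V → V → Prop) (L' : ∀ u w, B u w → ℂ), B = A → L' ≍ L →
        ∀ u w (e : A u w) (e' : B u w), L u w e = L' u w e' := by
      rintro B L' rfl h u w e e'
      rw [eq_of_heq h]
    exact key _ _ h1 h2 u w e ((hs u w).1 e)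
  · rintro ⟨hs, hl⟩
    have key : ∀ (B : V → V → Prop) (L' : ∀ u w, B u w → ℂ), B = A →
        (∀ u w (e : A u w) (e' : B u w), L u w e = L' u w e') → L' ≍ L := by
      rintro B L' rfl h
      apply heq_of_eq
      funext u w e
      exact (h u w e e).symm
    have h1 : (fun u w => A w u) = A := by
      funext u w
      exact propext (hs w u)
    exact ⟨h1, key _ _ h1 fun u w e e' => hl u w e⟩

end MarkedLabelledGraph

/-- A labelled connected marked graph. Connectedness is in the sense of directed paths, which is
what makes the directed distance finite; if the edge relation is symmetric, it is the same as
connectedness of the underlying undirected graph. -/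
structure LCMG extends MarkedLabelledGraph.{u} where
  countable : Countable V
  finite_out : ∀ u, {w | Adj u w}.Finite
  finite_in : ∀ u, {w | Adj w u}.Finite
  connected : ∀ u w, ∃ n, toMarkedLabelledGraph.HasWalk u w n

namespace LCMG

/-- The ball of radius `r` about the marked vertex: the full subgraph on the vertices `u` with
`dist u root ≤ r`. -/
def ball (X : LCMG.{u}) (r : ℕ) : MarkedLabelledGraph.{u} where
  V := {u : X.V // X.dist u X.root ≤ r}
  Adj u w := X.Adj u w
  label u w h := X.label u w h
  root := ⟨X.root, by
    have h : X.dist X.root X.root ≤ 0 :=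
      Nat.sInf_le ⟨fun _ => X.root, rfl, rfl, fun i hi => absurd hi (Nat.not_lt_zero i)⟩
    exact h.trans (Nat.zero_le r)⟩

/-- The distance between labelled connected marked graphs: the infimum of the numbers `1 / (n + 1)`
over all `n` for which the balls of radius `n` are isomorphic. The infimum of the empty set (the
balls of radius `0` may already differ, by the loop at the marked vertex) is `∞`. -/
noncomputable def ballDist (X Y : LCMG.{u}) : ℝ≥0∞ :=
  ⨅ n ∈ {n : ℕ | (X.ball n).Isomorphic (Y.ball n)}, 1 / ((n : ℝ≥0∞) + 1)

/-- `X` is equal to its involution. -/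
def IsSelfInvolutive (X : LCMG.{u}) : Prop :=
  X.toMarkedLabelledGraph.involution = X.toMarkedLabelledGraph

/-- The Hilbert space of square-summable functions on the vertices. -/
abbrev L2 (X : LCMG.{u}) : Type u := lp (fun _ : X.V => ℂ) 2

/-- The formula `f ↦ (u ↦ ∑ L(w, u) f(w))`, the sum being over the (finitely many) edges `(w, u)`
that end at `u`. -/
noncomputable def markovFun (X : LCMG.{u}) (f : X.V → ℂ) (u : X.V) : ℂ :=
  ∑ᶠ w : {w : X.V // X.Adj w u}, X.label w u w.2 * f w

/-- The Markov-type formula defines an operator from `ℓ²(V)` to `ℓ²(V)`. -/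
def ActsOnL2 (X : LCMG.{u}) : Prop :=
  ∀ f : X.L2, Memℓp (X.markovFun f) 2

open Classical in
/-- The label of `(w, u)` if this is an edge, and `0` otherwise. -/
noncomputable def weight (X : LCMG.{u}) (w u : X.V) : ℂ :=
  if h : X.Adj w u then X.label w u h else 0

theorem markovFun_eq_sum (X : LCMG.{u}) (f : X.V → ℂ) (u : X.V) :
    X.markovFun f u = ∑ w ∈ (X.finite_in u).toFinset, X.weight w u * f w := by
  have h1 : X.markovFun f u = ∑ᶠ w : {w : X.V // X.Adj w u}, X.weight w u * f w := by
    unfold markovFun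
    refine finsum_congr fun w => ?_
    rw [weight, dif_pos w.2]
  rw [h1, ← finsum_mem_eq_finite_toFinset_sum _ (X.finite_in u)]
  exact finsum_set_coe_eq_finsum_mem (f := fun w => X.weight w u * f w) {w | X.Adj w u}

/-- The Markov-type operator as a linear map. -/
noncomputable def markovLin (X : LCMG.{u}) (hX : X.ActsOnL2) : X.L2 →ₗ[ℂ] X.L2 where
  toFun f := ⟨X.markovFun f, hX f⟩
  map_add' f g := by
    ext u
    change X.markovFun (⇑f + ⇑g) u = X.markovFun f u + X.markovFun g u
    simp [markovFun_eq_sum, mul_add, Finset.sum_add_distrib]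
  map_smul' c f := by
    ext u
    change X.markovFun (c • ⇑f) u = c * X.markovFun f u
    simp [markovFun_eq_sum, Finset.mul_sum, mul_left_comm]

/-- The Markov-type operator as a bounded operator; boundedness is the closed graph theorem. -/
noncomputable def markovOp (X : LCMG.{u}) (hX : X.ActsOnL2) : X.L2 →L[ℂ] X.L2 :=
  ContinuousLinearMap.ofSeqClosedGraph (g := X.markovLin hX) (by
    intro s x y hs hy
    have hc : ∀ v : X.V, Continuous fun f : X.L2 => f v := fun v =>
      (continuous_apply v).comp (lp.uniformContinuous_coe (p := 2)).continuous
    ext u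
    have h1 := ((hc u).tendsto y).comp hy
    refine tendsto_nhds_unique h1 ?_
    change Tendsto (fun n => X.markovFun (s n) u) atTop (𝓝 (X.markovFun x u))
    simp only [markovFun_eq_sum]
    exact tendsto_finsetSum _ fun w _ => (((hc w).tendsto x).comp hs).const_mul _)

theorem markovOp_apply (X : LCMG.{u}) (hX : X.ActsOnL2) (f : X.L2) (u : X.V) :
    X.markovOp hX f u = X.markovFun f u := rfl

open Classical in
/-- The standard basis vector `δ_x`. -/
noncomputable def delta (X : LCMG.{u}) (x : X.V) : X.L2 := lp.single 2 x (1 : ℂ)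

theorem norm_delta (X : LCMG.{u}) (x : X.V) : ‖X.delta x‖ = 1 := by
  classical
  rw [delta, lp.norm_single (by norm_num)]
  simp

theorem markovOp_isSelfAdjoint (X : LCMG.{u}) (hs : X.IsSelfInvolutive) (hX : X.ActsOnL2) :
    IsSelfAdjoint (X.markovOp hX) := by
  classical
  obtain ⟨hA, hL⟩ := (X.involution_eq_self_iff).1 hs
  have hw : ∀ u w, X.weight u w = conj (X.weight w u) := by
    intro u w
    unfold weight
    by_cases h : X.Adj u w
    · rw [dif_pos h, dif_pos ((hA u w).1 h), hL u w h]
    · rw [dif_neg h, dif_neg fun h' => h ((hA u w).2 h'), map_zero]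
  have hδ : ∀ u v, X.markovOp hX (X.delta u) v = X.weight u v := by
    intro u v
    rw [markovOp_apply, markovFun_eq_sum]
    by_cases h : X.Adj u v
    · rw [Finset.sum_eq_single u]
      · simp [delta]
      · intro b _ hb
        rw [delta, lp.single_apply_ne _ _ _ hb, mul_zero]
      · intro hu
        exact absurd ((X.finite_in v).mem_toFinset.2 h) hu
    · rw [weight, dif_neg h]
      refine Finset.sum_eq_zero fun b hb => ?_
      have hb' : b ≠ u := by
        rintro rfl
        exact h ((X.finite_in v).mem_toFinset.1 hb)
      rw [delta, lp.single_apply_ne _ _ _ hb', mul_zero]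
  rw [ContinuousLinearMap.isSelfAdjoint_iff']
  ext f u
  have h1 : (ContinuousLinearMap.adjoint (X.markovOp hX) f : X.L2) u
      = inner ℂ (X.delta u) (ContinuousLinearMap.adjoint (X.markovOp hX) f) := by
    rw [delta, lp.inner_single_left]
    simp
  rw [h1, ContinuousLinearMap.adjoint_inner_right, lp.inner_eq_tsum, markovOp_apply,
    markovFun_eq_sum, tsum_eq_sum (s := (X.finite_in u).toFinset)]
  · refine Finset.sum_congr rfl fun w _ => ?_
    rw [hδ, hw w u, RCLike.inner_apply, mul_comm]
  · intro w hwn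
    have : ¬ X.Adj u w := fun h => hwn ((X.finite_in u).mem_toFinset.2 ((hA u w).1 h))
    rw [hδ, weight, dif_neg this]
    simp

end LCMG

section SpectralMeasure

variable {H : Type u} [NormedAddCommGroup H] [InnerProductSpace ℂ H] [CompleteSpace H]

/-- The positive functional `f ↦ ⟨f(A) ξ, ξ⟩` on the continuous functions on the spectrum of a
bounded self-adjoint operator `A`, where `f(A)` is given by the continuous functional calculus. -/
noncomputable def spectralFunctional (A : H →L[ℂ] H) (hA : IsSelfAdjoint A) (ξ : H) :
    CompactlySupportedContinuousMap (spectrum ℝ A) ℝ →ₚ[ℝ] ℝ :=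
  PositiveLinearMap.mk₀
    { toFun := fun f => (inner ℂ ξ (cfcHom hA (f : C(spectrum ℝ A, ℝ)) ξ)).re
      map_add' := fun f g => by
        have : ((f + g : CompactlySupportedContinuousMap (spectrum ℝ A) ℝ) : C(spectrum ℝ A, ℝ))
            = (f : C(spectrum ℝ A, ℝ)) + (g : C(spectrum ℝ A, ℝ)) := rfl
        rw [this, map_add, add_apply, inner_add_right, Complex.add_re]
      map_smul' := fun c f => by
        have : ((c • f : CompactlySupportedContinuousMap (spectrum ℝ A) ℝ) : C(spectrum ℝ A, ℝ))
            = c • (f : C(spectrum ℝ A, ℝ)) := rfl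
        rw [this, map_smul, smul_apply, inner_smul_right_eq_smul,
          Complex.smul_re, RingHom.id_apply] }
    (fun f hf => by
      have h0 : 0 ≤ cfcHom hA (f : C(spectrum ℝ A, ℝ)) :=
        cfcHom_nonneg_iff hA |>.2 fun x => hf x
      exact ((ContinuousLinearMap.nonneg_iff_isPositive _).1 h0).re_inner_nonneg_right ξ)

/-- The spectral measure `B ↦ ⟨E_B ξ, ξ⟩` of a bounded self-adjoint operator `A` at the vector `ξ`,
as a Borel measure on `ℝ`: the measure carried by the spectrum of `A` that represents the
functional `f ↦ ⟨f(A) ξ, ξ⟩`. -/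
noncomputable def spectralMeasure (A : H →L[ℂ] H) (hA : IsSelfAdjoint A) (ξ : H) : Measure ℝ :=
  (RealRMK.rieszMeasure (spectralFunctional A hA ξ)).map Subtype.val

theorem spectralMeasure_isProbabilityMeasure (A : H →L[ℂ] H) (hA : IsSelfAdjoint A) (ξ : H)
    (hξ : ‖ξ‖ = 1) : IsProbabilityMeasure (spectralMeasure A hA ξ) := by
  have h := RealRMK.integral_rieszMeasure (spectralFunctional A hA ξ)
    (CompactlySupportedContinuousMap.continuousMapEquiv (1 : C(spectrum ℝ A, ℝ)))
  have h2 : spectralFunctional A hA ξ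
      (CompactlySupportedContinuousMap.continuousMapEquiv (1 : C(spectrum ℝ A, ℝ))) = 1 := by
    change (inner ℂ ξ (cfcHom hA (1 : C(spectrum ℝ A, ℝ)) ξ)).re = 1
    rw [map_one, one_apply_eq_self, inner_self_eq_norm_sq_to_K, hξ]
    simp
  rw [h2] at h
  have h3 : ∫ _ : spectrum ℝ A, (1 : ℝ) ∂(RealRMK.rieszMeasure (spectralFunctional A hA ξ)) = 1 := h
  have : IsProbabilityMeasure (RealRMK.rieszMeasure (spectralFunctional A hA ξ)) := by
    constructor
    rw [integral_const, smul_eq_mul, mul_one, Measure.real] at h3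
    rwa [ENNReal.toReal_eq_one_iff] at h3
  exact Measure.isProbabilityMeasure_map measurable_subtype_coe.aemeasurable

end SpectralMeasure

/-- The Kesten spectral measure of a self-involutive graph at the vertex `x`: the spectral measure
of its Markov-type operator at `δ_x`. -/
noncomputable def LCMG.kestenMeasure (X : LCMG.{u}) (hs : X.IsSelfInvolutive) (hX : X.ActsOnL2)
    (x : X.V) : ProbabilityMeasure ℝ :=
  ⟨spectralMeasure (X.markovOp hX) (X.markovOp_isSelfAdjoint hs hX) (X.delta x),
    spectralMeasure_isProbabilityMeasure _ _ _ (X.norm_delta x)⟩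

/-! ### Moments of spectral measures. -/

section SpectralMoments

variable {H : Type u} [NormedAddCommGroup H] [InnerProductSpace ℂ H] [CompleteSpace H]

/-! The argument is the method of moments. The `k`-th moment of the Kesten measure at the root is
`⟨M ^ k δ, δ⟩`, a weighted count of closed walks of length `k`, and so is determined by the ball of
radius `k` (`markovOp_pow_delta_root_eq`). Convergence in `ballDist` makes the balls of some radius
at least `k` isomorphic for all large `n`, so each moment is eventually equal to that of the limit.

The norms of the operators of the approximating graphs need not be uniformly bounded, so there may
be no common compact support. Only the limit measure needs moments bounded by `R ^ k`, with `R` the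
norm of its operator: the error of polynomial approximation is dominated by a polynomial with small
integral against the limit, and the integrals of that polynomial converge too
(`exists_polynomial_abs_sub_le_polynomial`). -/

theorem integral_spectralMeasure (A : H →L[ℂ] H) (hA : IsSelfAdjoint A) (ξ : H) (g : C(ℝ, ℝ)) :
    ∫ x, g x ∂(spectralMeasure A hA ξ) = (inner ℂ ξ (cfc g A ξ)).re := by
  rw [spectralMeasure, integral_map measurable_subtype_coe.aemeasurable
    g.continuous.aestronglyMeasurable, cfc_apply g A hA g.continuous.continuousOn]
  exact RealRMK.integral_rieszMeasure (spectralFunctional A hA ξ)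
    (CompactlySupportedContinuousMap.continuousMapEquiv (g.restrict (spectrum ℝ A)))

theorem integrable_spectralMeasure (A : H →L[ℂ] H) (hA : IsSelfAdjoint A) (ξ : H) (g : C(ℝ, ℝ)) :
    Integrable g (spectralMeasure A hA ξ) := by
  rw [spectralMeasure, integrable_map_measure g.continuous.aestronglyMeasurable
    measurable_subtype_coe.aemeasurable]
  exact (g.continuous.comp continuous_subtype_val).integrable_of_hasCompactSupport
    (HasCompactSupport.of_compactSpace _)

theorem integral_pow_spectralMeasure (A : H →L[ℂ] H) (hA : IsSelfAdjoint A) (ξ : H) (k : ℕ) :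
    ∫ x, x ^ k ∂(spectralMeasure A hA ξ) = (inner ℂ ξ ((A ^ k) ξ)).re := by
  have h := integral_spectralMeasure A hA ξ ⟨fun x => x ^ k, by fun_prop⟩
  have h2 : cfc (fun x : ℝ => x ^ k) A = A ^ k := cfc_pow_id A k
  simpa [h2] using h

theorem integrable_pow_spectralMeasure (A : H →L[ℂ] H) (hA : IsSelfAdjoint A) (ξ : H) (k : ℕ) :
    Integrable (fun x : ℝ => x ^ k) (spectralMeasure A hA ξ) :=
  integrable_spectralMeasure A hA ξ ⟨fun x => x ^ k, by fun_prop⟩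

theorem integral_pow_spectralMeasure_le (A : H →L[ℂ] H) (hA : IsSelfAdjoint A) (ξ : H)
    (hξ : ‖ξ‖ = 1) (k : ℕ) :
    ∫ x, x ^ k ∂(spectralMeasure A hA ξ) ≤ ‖A‖ ^ k := by
  -- This gives `‖1‖ = 1` for operators, which the case `k = 0` of `norm_pow_le` needs.
  have : Nontrivial H := ⟨ξ, 0, by rintro rfl; simp at hξ⟩
  rw [integral_pow_spectralMeasure]
  calc (inner ℂ ξ ((A ^ k) ξ)).re ≤ ‖inner ℂ ξ ((A ^ k) ξ)‖ := Complex.re_le_norm _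
    _ ≤ ‖ξ‖ * ‖(A ^ k) ξ‖ := norm_inner_le_norm _ _
    _ ≤ ‖ξ‖ * (‖A ^ k‖ * ‖ξ‖) := by gcongr; exact (A ^ k).le_opNorm ξ
    _ ≤ ‖A‖ ^ k := by simpa [hξ] using norm_pow_le A k

end SpectralMoments

/-! ### The method of moments on the real line. -/

section Moments

/-- Outside the unit interval every lower power is dominated by a higher one; the even exponent
makes the bound itself a polynomial in `x`. -/
theorem Polynomial.abs_eval_le_of_one_le_abs (p : Polynomial ℝ) {x : ℝ} (hx : 1 ≤ |x|) :
    |p.eval x| ≤ (∑ i ∈ Finset.range (p.natDegree + 1), |p.coeff i|) * x ^ (2 * p.natDegree) := by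
  rw [Polynomial.eval_eq_sum_range, Finset.sum_mul]
  refine (Finset.abs_sum_le_sum_abs _ _).trans (Finset.sum_le_sum fun i hi => ?_)
  rw [abs_mul, abs_pow, pow_mul, ← sq_abs, ← pow_mul]
  have : i < p.natDegree + 1 := Finset.mem_range.1 hi
  gcongr
  omega

theorem Polynomial.integrable_eval_of_moments {μ : Measure ℝ}
    (h : ∀ k : ℕ, Integrable (fun x : ℝ => x ^ k) μ) (p : Polynomial ℝ) :
    Integrable (fun x => p.eval x) μ := by
  simp only [Polynomial.eval_eq_sum_range]
  exact integrable_finsetSum _ fun i _ => (h i).const_mul _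

theorem Polynomial.integral_eval_eq_sum_moments {μ : Measure ℝ}
    (h : ∀ k : ℕ, Integrable (fun x : ℝ => x ^ k) μ) (p : Polynomial ℝ) :
    ∫ x, p.eval x ∂μ = ∑ i ∈ Finset.range (p.natDegree + 1), p.coeff i * ∫ x, x ^ i ∂μ := by
  simp only [Polynomial.eval_eq_sum_range]
  rw [integral_finsetSum _ fun i _ => (h i).const_mul _]
  simp only [integral_const_mul]

/-- A bounded continuous function is approximated by polynomials, with an error that is dominated
by a polynomial of small integral, for every measure with exponentially bounded moments. -/
theorem exists_polynomial_abs_sub_le_polynomial {ν : Measure ℝ} [IsProbabilityMeasure ν]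
    (hν : ∀ k : ℕ, Integrable (fun x : ℝ => x ^ k) ν) {R : ℝ} (hR0 : 0 ≤ R)
    (hR : ∀ k : ℕ, ∫ x, x ^ k ∂ν ≤ R ^ k) (f : BoundedContinuousFunction ℝ ℝ) {ε : ℝ}
    (hε : 0 < ε) :
    ∃ p q : Polynomial ℝ, (∀ x, |f x - p.eval x| ≤ q.eval x) ∧ ∫ x, q.eval x ∂ν < ε := by
  -- `S > R` makes `(R / S) ^ (2 * k)` tend to `0`, and `S ≥ 1` lets the growth bound for `p` apply
  -- beyond `S`.
  set S := R + 1 with hS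
  have hS0 : 0 < S := by positivity
  obtain ⟨p, hp⟩ := exists_polynomial_near_of_continuousOn (-S) S f f.continuous.continuousOn
    (ε / 2) (half_pos hε)
  set d := p.natDegree
  set C := ‖f‖ + ∑ i ∈ Finset.range (d + 1), |p.coeff i| with hC
  have hC0 : 0 ≤ C := by positivity
  have hlim : Tendsto (fun k : ℕ => C * R ^ (2 * d) * ((R / S) ^ 2) ^ k) atTop (𝓝 0) := by
    have hq : R / S < 1 := by rw [div_lt_one hS0]; linarith
    have := tendsto_pow_atTop_nhds_zero_of_lt_one (r := (R / S) ^ 2) (by positivity)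
      (pow_lt_one₀ (by positivity) hq two_ne_zero)
    simpa using this.const_mul (C * R ^ (2 * d))
  obtain ⟨k, hk⟩ := (hlim.eventually (gt_mem_nhds (half_pos hε))).exists
  -- The constant controls the error on `[-S, S]`. Beyond it the error is at most `C * x ^ (2 * d)`,
  -- and the factor `(x / S) ^ (2 * k) ≥ 1` is free there while making the integral small.
  refine ⟨p, Polynomial.C (ε / 2) +
    Polynomial.C (C * (S⁻¹ ^ 2) ^ k) * Polynomial.X ^ (2 * d + 2 * k), fun x => ?_, ?_⟩
  · have hnn : 0 ≤ (C * (S⁻¹ ^ 2) ^ k) * x ^ (2 * d + 2 * k) := by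
      rw [← mul_add, pow_mul x]; positivity
    simp only [Polynomial.eval_add, Polynomial.eval_C, Polynomial.eval_mul, Polynomial.eval_pow,
      Polynomial.eval_X]
    rcases le_total |x| S with hx | hx
    · have := hp x (abs_le.1 hx)
      rw [abs_sub_comm] at this
      linarith
    · have hx1 : 1 ≤ |x| := by linarith
      have h1 : 1 ≤ x ^ (2 * d) := by
        rw [pow_mul, ← sq_abs]; exact one_le_pow₀ (one_le_pow₀ hx1)
      have h2 : 1 ≤ (S⁻¹ ^ 2) ^ k * x ^ (2 * k) := by
        rw [pow_mul, ← mul_pow, ← mul_pow, ← sq_abs, abs_mul, abs_of_pos (inv_pos.2 hS0),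
          inv_mul_eq_div]
        exact one_le_pow₀ (one_le_pow₀ ((one_le_div hS0).2 hx))
      have h3 : |f x - p.eval x| ≤ C * x ^ (2 * d) := by
        have hf : |f x| ≤ ‖f‖ * x ^ (2 * d) :=
          (f.norm_coe_le_norm x).trans (le_mul_of_one_le_right (norm_nonneg f) h1)
        have := p.abs_eval_le_of_one_le_abs hx1
        rw [hC, add_mul]
        exact (abs_sub _ _).trans (add_le_add hf this)
      have h4 : C * x ^ (2 * d) ≤ C * x ^ (2 * d) * ((S⁻¹ ^ 2) ^ k * x ^ (2 * k)) :=
        le_mul_of_one_le_right (by positivity) h2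
      rw [pow_add]
      linarith
  · simp only [Polynomial.eval_add, Polynomial.eval_C, Polynomial.eval_mul, Polynomial.eval_pow,
      Polynomial.eval_X]
    rw [integral_add (integrable_const _) ((hν _).const_mul _), integral_const_mul]
    simp only [integral_const, probReal_univ, one_smul]
    have h5 : (C * (S⁻¹ ^ 2) ^ k) * ∫ x, x ^ (2 * d + 2 * k) ∂ν
        ≤ C * R ^ (2 * d) * ((R / S) ^ 2) ^ k := by
      refine (mul_le_mul_of_nonneg_left (hR _) (by positivity)).trans_eq ?_
      rw [div_eq_mul_inv, mul_pow, mul_pow, pow_add, ← pow_mul R 2 k]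
      ring
    linarith

/-- **Method of moments**: convergence of all moments to those of a probability measure with
exponentially bounded moments implies weak convergence. -/
theorem MeasureTheory.ProbabilityMeasure.tendsto_of_tendsto_moments {ι : Type*} {l : Filter ι}
    {μ : ι → ProbabilityMeasure ℝ} {ν : ProbabilityMeasure ℝ}
    (hμ : ∀ i, ∀ k : ℕ, Integrable (fun x : ℝ => x ^ k) (μ i : Measure ℝ))
    (hν : ∀ k : ℕ, Integrable (fun x : ℝ => x ^ k) (ν : Measure ℝ))
    {R : ℝ} (hR0 : 0 ≤ R) (hR : ∀ k : ℕ, ∫ x, x ^ k ∂(ν : Measure ℝ) ≤ R ^ k)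
    (h : ∀ k : ℕ, Tendsto (fun i => ∫ x, x ^ k ∂(μ i : Measure ℝ)) l
      (𝓝 (∫ x, x ^ k ∂(ν : Measure ℝ)))) :
    Tendsto μ l (𝓝 ν) := by
  have hpoly : ∀ p : Polynomial ℝ, Tendsto (fun i => ∫ x, p.eval x ∂(μ i : Measure ℝ)) l
      (𝓝 (∫ x, p.eval x ∂(ν : Measure ℝ))) := by
    intro p
    simp only [p.integral_eval_eq_sum_moments (hμ _), p.integral_eval_eq_sum_moments hν]
    exact tendsto_finsetSum _ fun i _ => (h i).const_mul _
  rw [ProbabilityMeasure.tendsto_iff_forall_integral_tendsto]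
  intro f
  rw [Metric.tendsto_nhds]
  intro ε hε
  obtain ⟨p, q, hpq, hq⟩ := exists_polynomial_abs_sub_le_polynomial hν hR0 hR f
    (show 0 < ε / 3 by positivity)
  -- Applied to both `μ i` and `ν`; together with the convergence of `∫ p` this gives three errors
  -- below `ε / 3`.
  have key : ∀ ρ : ProbabilityMeasure ℝ,
      (∀ k : ℕ, Integrable (fun x : ℝ => x ^ k) (ρ : Measure ℝ)) →
      |∫ x, f x ∂(ρ : Measure ℝ) - ∫ x, p.eval x ∂(ρ : Measure ℝ)|
        ≤ ∫ x, q.eval x ∂(ρ : Measure ℝ) := by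
    intro ρ hρ
    rw [← integral_sub (f.integrable _) (p.integrable_eval_of_moments hρ)]
    exact norm_integral_le_of_norm_le (f := fun x => f x - p.eval x)
      (q.integrable_eval_of_moments hρ) (ae_of_all _ hpq)
  filter_upwards [(hpoly q).eventually (gt_mem_nhds hq),
    Metric.tendsto_nhds.1 (hpoly p) (ε / 3) (by positivity)] with i hi1 hi2
  have k1 := abs_le.1 (key (μ i) (hμ i))
  have k2 := abs_le.1 (key ν hν)
  rw [Real.dist_eq, abs_lt] at hi2 ⊢
  constructor <;> linarith [k1.1, k1.2, k2.1, k2.2, hi2.1, hi2.2]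

end Moments

/-! ### Locality of powers of the Markov-type operator. -/

namespace LCMG

theorem delta_apply_self (X : LCMG.{u}) (x : X.V) : X.delta x x = 1 := by
  classical
  exact lp.single_apply_self _ _ _

theorem delta_apply_ne (X : LCMG.{u}) {x y : X.V} (h : y ≠ x) : X.delta x y = 0 := by
  classical
  exact lp.single_apply_ne _ _ _ h

theorem dist_le_succ (X : LCMG.{u}) {u w x : X.V} (h : X.Adj u w) :
    X.dist u x ≤ X.dist w x + 1 := by
  -- Connectedness makes the set of lengths nonempty, so that its infimum is attained rather than
  -- the default `0`.
  have hw : X.HasWalk w x (X.dist w x) := Nat.sInf_mem (X.connected w x)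
  obtain ⟨p, h0, hn, hp⟩ := hw
  refine Nat.sInf_le ⟨fun i => Nat.casesOn i u p, rfl, hn, fun i hi => ?_⟩
  cases i with
  | zero => simpa [h0] using h
  | succ i => exact hp i (by omega)

theorem IsSelfInvolutive.adj_symm {X : LCMG.{u}} (hs : X.IsSelfInvolutive) {u w : X.V}
    (h : X.Adj u w) : X.Adj w u :=
  ((X.involution_eq_self_iff.1 hs).1 u w).1 h

/-- Each application of the operator spreads the support by one edge away from the root. Distances
are measured towards the root, so the edge has to be reversed, by self-involutivity. -/
theorem dist_root_le_of_markovOp_pow_ne_zero (X : LCMG.{u}) (hs : X.IsSelfInvolutive)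
    (hX : X.ActsOnL2) (j : ℕ) (u : X.V)
    (hu : (X.markovOp hX ^ j) (X.delta X.root) u ≠ 0) : X.dist u X.root ≤ j := by
  induction j generalizing u with
  | zero =>
    have : u = X.root := by
      by_contra hne
      exact hu (X.delta_apply_ne hne)
    subst this
    exact (X.ball 0).root.2
  | succ j ih =>
    rw [pow_succ', mul_apply_eq_comp, markovOp_apply, markovFun_eq_sum] at hu
    obtain ⟨w, hw, hne⟩ := Finset.exists_ne_zero_of_sum_ne_zero hu
    have hadj : X.Adj w u := (X.finite_in u).mem_toFinset.1 hw
    exact (X.dist_le_succ (hs.adj_symm hadj)).trans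
      (Nat.succ_le_succ (ih w (right_ne_zero_of_mul hne)))

theorem markovFun_eq_finsum_ball (X : LCMG.{u}) (n : ℕ) (f : X.V → ℂ)
    (hf : ∀ w, f w ≠ 0 → X.dist w X.root ≤ n) (u : X.V) :
    X.markovFun f u = ∑ᶠ w : (X.ball n).V, X.weight w.1 u * f w.1 := by
  have h : X.markovFun f u = ∑ᶠ w, X.weight w u * f w := by
    rw [markovFun_eq_sum, finsum_eq_sum_of_support_subset]
    intro w hw
    rw [Finset.mem_coe, Set.Finite.mem_toFinset]
    by_contra hn
    exact left_ne_zero_of_mul hw (dif_neg hn)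
  rw [h, ← finsum_mem_univ, finsum_mem_inter_support_eq' _ Set.univ {w | X.dist w X.root ≤ n}
    fun w hw => iff_of_true (Set.mem_univ w) (hf w (right_ne_zero_of_mul hw))]
  exact (finsum_set_coe_eq_finsum_mem (f := fun w => X.weight w u * f w)
    {w | X.dist w X.root ≤ n}).symm

theorem markovOp_pow_delta_root_eq (X Y : LCMG.{u}) (hXs : X.IsSelfInvolutive)
    (hYs : Y.IsSelfInvolutive) (hX : X.ActsOnL2) (hY : Y.ActsOnL2) {n : ℕ}
    (hiso : (X.ball n).Isomorphic (Y.ball n)) {j : ℕ} (hj : j ≤ n) :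
    (X.markovOp hX ^ j) (X.delta X.root) X.root = (Y.markovOp hY ^ j) (Y.delta Y.root) Y.root := by
  obtain ⟨φ, hroot, hadj, hlabel⟩ := hiso
  have hweight : ∀ u w : (X.ball n).V, X.weight u.1 w.1 = Y.weight (φ u).1 (φ w).1 := by
    intro u w
    unfold weight
    by_cases h : X.Adj u.1 w.1
    · have h' : Y.Adj (φ u).1 (φ w).1 := (hadj u w).1 h
      rw [dif_pos h, dif_pos h']
      exact hlabel u w h
    · have h' : ¬ Y.Adj (φ u).1 (φ w).1 := fun h' => h ((hadj u w).2 h')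
      rw [dif_neg h, dif_neg h']
  -- The induction needs agreement on the whole ball, not only at the root. Neighbours outside the
  -- ball do no harm: for `i < n` the `i`-th iterate vanishes there.
  have key : ∀ i ≤ n, ∀ u : (X.ball n).V,
      (X.markovOp hX ^ i) (X.delta X.root) u.1 = (Y.markovOp hY ^ i) (Y.delta Y.root) (φ u).1 := by
    intro i
    induction i with
    | zero =>
      intro _ u
      change X.delta X.root u.1 = Y.delta Y.root (φ u).1
      by_cases hu : u = (X.ball n).root
      · subst hu
        rw [hroot]
        exact (X.delta_apply_self _).trans (Y.delta_apply_self _).symm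
      · have h1 : u.1 ≠ X.root := fun h => hu (Subtype.ext h)
        have h2 : (φ u).1 ≠ Y.root := fun h => hu (φ.injective (by
          rw [hroot]; exact Subtype.ext h))
        exact (X.delta_apply_ne h1).trans (Y.delta_apply_ne h2).symm
    | succ i ih =>
      intro hi u
      rw [pow_succ', pow_succ', mul_apply_eq_comp, mul_apply_eq_comp,
        markovOp_apply, markovOp_apply,
        X.markovFun_eq_finsum_ball n _ fun w hw =>
          (X.dist_root_le_of_markovOp_pow_ne_zero hXs hX i w hw).trans (by omega),
        Y.markovFun_eq_finsum_ball n _ fun w hw =>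
          (Y.dist_root_le_of_markovOp_pow_ne_zero hYs hY i w hw).trans (by omega)]
      refine finsum_eq_of_bijective φ φ.bijective fun w => ?_
      rw [hweight w u, ih (by omega) w]
  have h := key j hj (X.ball n).root
  rw [hroot] at h
  exact h

theorem integral_pow_kestenMeasure (X : LCMG.{u}) (hs : X.IsSelfInvolutive) (hX : X.ActsOnL2)
    (x : X.V) (k : ℕ) :
    ∫ t, t ^ k ∂(X.kestenMeasure hs hX x : Measure ℝ)
      = ((X.markovOp hX ^ k) (X.delta x) x).re := by
  refine (integral_pow_spectralMeasure _ _ _ k).trans ?_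
  classical
  conv_lhs => rw [delta, lp.inner_single_left]
  simp [delta]

theorem exists_ball_isomorphic_of_ballDist_lt (X Y : LCMG.{u}) (k : ℕ)
    (h : ballDist X Y < 1 / ((k : ℝ≥0∞) + 1)) :
    ∃ n, k ≤ n ∧ (X.ball n).Isomorphic (Y.ball n) := by
  simp only [ballDist, iInf_lt_iff] at h
  obtain ⟨n, hn, hlt⟩ := h
  refine ⟨n, ?_, hn⟩
  by_contra! hk
  refine absurd hlt (not_lt.2 ?_)
  gcongr

end LCMG

theorem theorem4 (X : ℕ → LCMG.{u}) (Y : LCMG.{u})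
    (hXs : ∀ n, (X n).IsSelfInvolutive) (hYs : Y.IsSelfInvolutive)
    (hXb : ∀ n, (X n).ActsOnL2) (hYb : Y.ActsOnL2)
    (hconv : Tendsto (fun n => LCMG.ballDist (X n) Y) atTop (𝓝 0)) :
    Tendsto (fun n => (X n).kestenMeasure (hXs n) (hXb n) (X n).root) atTop
      (𝓝 (Y.kestenMeasure hYs hYb Y.root)) := by
  refine ProbabilityMeasure.tendsto_of_tendsto_moments
    (fun n k => integrable_pow_spectralMeasure _ _ _ k)
    (fun k => integrable_pow_spectralMeasure _ _ _ k)
    (norm_nonneg (Y.markovOp hYb))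
    (fun k => integral_pow_spectralMeasure_le _ _ _ (Y.norm_delta _) k) fun k => ?_
  -- The sequence of `k`-th moments is eventually constant.
  refine tendsto_const_nhds.congr' ?_
  have hpos : (0 : ℝ≥0∞) < 1 / ((k : ℝ≥0∞) + 1) := by
    simp
  filter_upwards [hconv.eventually (gt_mem_nhds hpos)] with n hn
  obtain ⟨m, hkm, hiso⟩ := LCMG.exists_ball_isomorphic_of_ballDist_lt _ _ k hn
  rw [LCMG.integral_pow_kestenMeasure, LCMG.integral_pow_kestenMeasure,
    LCMG.markovOp_pow_delta_root_eq (X n) Y (hXs n) hYs (hXb n) hYb hiso hkm]
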